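/- Let $\Gamma$ be a locally finite connected graph with vertex set $V$ and graph distance $d$, and let $(\xi_i)_{i\ge 1}$ be a sequence of independent, identically distributed random vertices, i.e. measurable functions $\xi_i:\Omega\to V$ on a probability space $(\Omega,\mathcal F,\mathbf P)$. Put $\mu(s)=\mathbf P(\xi_1=s)$ and $M(v)=\sum_{s\in V} d(v,s)^2\mu(s)$, and suppose that $M$ is totally defined, i.e. $M(v)<\infty$ for every $v\in V$. Let $$\mathbb E(\xi_1)=\{v\in V : M(v)\le M(u)\ \text{for all } u\in V\}$$ be the mean-set of $\xi_1$. For $n\ge 1$ let $\mu_n(s)=\frac1n\,|\{1\le i\le n : \xi_i=s\}|$ be the relative frequencies, let $M_n(v)=\sum_{s\in V} d(v,s)^2\mu_n(s)$, and let $$\mathbb S_n=\{v\in V : M_n(v)\le M_n(u)\ \text{for all } u\in V\}$$ be the sample mean-set of $\xi_1,\dots,\xi_n$. If $2\le|\mathbb E(\xi_1)|\le 3$, then with probability one $$\limsup_{n\to\infty}\mathbb S_n=\mathbb E(\xi_1),$$ where $\limsup_{n\to\infty}\mathbb S_n=\bigcap_{m\ge 1}\bigcup_{n\ge m}\mathbb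 S_n$ is the set of vertices that lie in $\mathbb S_n$ for infinitely many $n$. -/

import Mathlib

open Filter MeasureTheory ProbabilityTheory

namespace GraphMean

noncomputable section

/-- The atomic measure `v ↦ P (ξ = v)` induced on the vertices by a random vertex `ξ`. -/
def vertexMeasure {V Ω : Type*} [MeasurableSpace Ω] (P : Measure Ω) (ξ : Ω → V) (v : V) : ℝ :=
  P.real {ω | ξ ω = v}

/-- The weight `∑ s, d(v, s) ^ 2 * μ s` is finite at the vertex `v`. -/
def WeightDefinedAt {V : Type*} (G : SimpleGraph V) (μ : V → ℝ) (v : V) : Prop :=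
  Summable fun s : V => (G.dist v s : ℝ) ^ 2 * μ s

/-- The weight function is finite at every vertex. -/
def WeightTotallyDefined {V : Type*} (G : SimpleGraph V) (μ : V → ℝ) : Prop :=
  ∀ v : V, WeightDefinedAt G μ v

/-- The weight function `M v = ∑ s, d(v, s) ^ 2 * μ s`. -/
def weight {V : Type*} (G : SimpleGraph V) (μ : V → ℝ) (v : V) : ℝ :=
  ∑' s : V, (G.dist v s : ℝ) ^ 2 * μ s

/-- The mean-set of `μ`: all the vertices at which the weight function is minimal. -/
def meanSet {V : Type*} (G : SimpleGraph V) (μ : V → ℝ) : Set V :=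
  {v | ∀ u : V, weight G μ v ≤ weight G μ u}

/-- The relative frequency of the vertex `u` among the first `n` terms of the sequence `x`. -/
def relFreq {V : Type*} (x : ℕ → V) (n : ℕ) (u : V) : ℝ :=
  ({i : ℕ | i < n ∧ x i = u}.ncard : ℝ) / n

/-- The sample mean-set of the first `n` terms `x 0, …, x (n - 1)` of the sequence `x`.
(For the empty sample, `n = 0`, it is the set of all vertices.) -/
def sampleMeanSet {V : Type*} (G : SimpleGraph V) (x : ℕ → V) (n : ℕ) : Set V :=
  meanSet G (relFreq x n)

end

end GraphMean

/-! Fix `v` in the mean-set and let `w₁`, `w₂` be the others, with a repetition if there are only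
two vertices. The differences of squared distances `d(wⱼ, ξᵢ)² - d(v, ξᵢ)²` are the steps of a
random walk on `ℤ × ℤ`. The walk is centred because the minimal weights agree, and it has finite
second moments because `|d(w, s) - d(v, s)| ≤ d(v, w)`. Planar walks of this kind are recurrent, and
at each return to the origin the sample weights of the whole mean-set coincide. The bound three on
the cardinality is what keeps the walk planar. By the strong law and local finiteness, eventually
every vertex outside the mean-set is heavier than `v`; so late return times put the whole mean-set
into the sample mean-set, and no other vertex occurs infinitely often (`eventually_weight_lt`).

Recurrence is proved by Fourier analysis. With `φ` the characteristic function of a step, `∑ rⁿ P(Sₙ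
= 0)` is a multiple of `∫ Re (1 - r φ)⁻¹`. Near the origin the integrand is at least `κ / (1 - r + C
|t|²)` (`exists_resolvent_bound`), whose integral diverges logarithmically as `r → 1`. So the
expected number of returns is infinite (`not_summable_return`), and a last-exit decomposition gives
infinitely many returns almost surely. -/

namespace GraphMean

/-! ### Characters of the planar lattice and their orthogonality -/

/-- The pairing of a frequency `t` with a lattice point `x`. -/
def dualPairing (t : ℝ × ℝ) (x : ℤ × ℤ) : ℝ := t.1 * x.1 + t.2 * x.2

lemma measurable_dualPairing_left (x : ℤ × ℤ) : Measurable fun t => dualPairing t x := by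
  unfold dualPairing; fun_prop

lemma measurable_dualPairing : Measurable fun p : (ℝ × ℝ) × (ℤ × ℤ) => dualPairing p.1 p.2 :=
  measurable_from_prod_countable_left measurable_dualPairing_left

lemma dualPairing_add (t : ℝ × ℝ) (x y : ℤ × ℤ) :
    dualPairing t (x + y) = dualPairing t x + dualPairing t y := by
  simp only [dualPairing, Prod.fst_add, Prod.snd_add, Int.cast_add]; ring

lemma dualPairing_sq_le (t : ℝ × ℝ) (x : ℤ × ℤ) :
    dualPairing t x ^ 2 ≤ (t.1 ^ 2 + t.2 ^ 2) * ((x.1 : ℝ) ^ 2 + (x.2 : ℝ) ^ 2) := by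
  unfold dualPairing
  nlinarith [sq_nonneg (t.1 * x.2 - t.2 * x.1)]

lemma norm_exp_dualPairing (t : ℝ × ℝ) (x : ℤ × ℤ) :
    ‖Complex.exp (Complex.I * dualPairing t x)‖ = 1 :=
  Complex.norm_exp_I_mul_ofReal _

/-- Taylor's bound serves for `|u| ≤ 1`; beyond that, the triangle inequality gives `2 |u| ≤ 2 u²`.
-/
lemma norm_exp_I_mul_sub_one_sub_le (u : ℝ) :
    ‖Complex.exp (Complex.I * u) - 1 - Complex.I * u‖ ≤ 2 * u ^ 2 := by
  have hn : ‖Complex.I * (u : ℂ)‖ = |u| := by simp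
  rcases le_total |u| 1 with h | h
  · have := Complex.norm_exp_sub_one_sub_id_le (x := Complex.I * u) (by rwa [hn])
    rw [hn, sq_abs] at this
    nlinarith [sq_nonneg u]
  · have h1 := Real.norm_exp_I_mul_ofReal_sub_one_le (x := u)
    rw [Real.norm_eq_abs] at h1
    have := norm_sub_le (Complex.exp (Complex.I * u) - 1) (Complex.I * u)
    rw [hn] at this
    nlinarith [sq_abs u]

/-- The fundamental square of frequencies. -/
def frequencySquare : Set (ℝ × ℝ) := Set.Ioc (-Real.pi) Real.pi ×ˢ Set.Ioc (-Real.pi) Real.pi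

lemma volume_frequencySquare_lt_top : volume frequencySquare < ⊤ := by
  rw [frequencySquare, Measure.volume_eq_prod, Measure.prod_prod]
  simp [ENNReal.mul_lt_top]

instance : IsFiniteMeasure (volume.restrict frequencySquare) :=
  ⟨by simpa using volume_frequencySquare_lt_top⟩

lemma setIntegral_exp_I_mul_int (a : ℤ) :
    ∫ t in Set.Ioc (-Real.pi) Real.pi, Complex.exp (Complex.I * ((t * a : ℝ) : ℂ)) =
      if a = 0 then 2 * (Real.pi : ℂ) else 0 := by
  rw [← intervalIntegral.integral_of_le (by linarith [Real.pi_pos])]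
  split_ifs with h
  · subst h
    simp; ring
  · have hc : (Complex.I * a : ℂ) ≠ 0 := by simp [h]
    have := integral_exp_mul_complex (a := -Real.pi) (b := Real.pi) hc
    calc _ = ∫ x in (-Real.pi)..Real.pi, Complex.exp (Complex.I * a * x) := by
          congr 1; ext t; push_cast; congr 1; ring
      _ = 0 := by
          rw [this, div_eq_zero_iff]
          left
          rw [sub_eq_zero, Complex.exp_eq_exp_iff_exists_int]
          exact ⟨a, by push_cast; ring⟩

lemma setIntegral_exp_dualPairing (x : ℤ × ℤ) :
    ∫ t in frequencySquare, Complex.exp (Complex.I * dualPairing t x) =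
      if x = 0 then ((4 * Real.pi ^ 2 : ℝ) : ℂ) else 0 := by
  have h := setIntegral_prod_mul (μ := (volume : Measure ℝ)) (ν := (volume : Measure ℝ))
    (fun t : ℝ => Complex.exp (Complex.I * ((t * x.1 : ℝ) : ℂ)))
    (fun t : ℝ => Complex.exp (Complex.I * ((t * x.2 : ℝ) : ℂ)))
    (Set.Ioc (-Real.pi) Real.pi) (Set.Ioc (-Real.pi) Real.pi)
  rw [setIntegral_exp_I_mul_int, setIntegral_exp_I_mul_int] at h
  calc _ = _ := by
        rw [frequencySquare, Measure.volume_eq_prod]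
        congr 1; ext t
        rw [← Complex.exp_add]; unfold dualPairing; push_cast; congr 1; ring
    _ = _ := h
    _ = _ := by
        by_cases h1 : x.1 = 0 <;> by_cases h2 : x.2 = 0 <;> simp [h1, h2, Prod.ext_iff]
        ring

/-! ### Characteristic functions of lattice walks -/

section Characteristic

variable {Ω : Type*} [MeasurableSpace Ω] {P : Measure Ω} [IsProbabilityMeasure P]

/-- The characteristic function of a random lattice point. -/
noncomputable def latticeChar (P : Measure Ω) (Y : Ω → ℤ × ℤ) (t : ℝ × ℝ) : ℂ :=
  ∫ ω, Complex.exp (Complex.I * dualPairing t (Y ω)) ∂P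

lemma measurable_exp_dualPairing {Y : Ω → ℤ × ℤ} (hY : Measurable Y) (t : ℝ × ℝ) :
    Measurable fun ω => Complex.exp (Complex.I * dualPairing t (Y ω)) := by
  have : Measurable fun ω => dualPairing t (Y ω) :=
    measurable_dualPairing.comp (measurable_const.prodMk hY)
  fun_prop

lemma integrable_exp_dualPairing {Y : Ω → ℤ × ℤ} (hY : Measurable Y) (t : ℝ × ℝ) :
    Integrable (fun ω => Complex.exp (Complex.I * dualPairing t (Y ω))) P :=
  .of_bound (measurable_exp_dualPairing hY t).aestronglyMeasurable 1
    (.of_forall fun _ => (norm_exp_dualPairing _ _).le)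

lemma stronglyMeasurable_uncurry_exp {Y : Ω → ℤ × ℤ} (hY : Measurable Y) :
    StronglyMeasurable fun p : (ℝ × ℝ) × Ω =>
      Complex.exp (Complex.I * dualPairing p.1 (Y p.2)) := by
  have : Measurable fun p : (ℝ × ℝ) × Ω => dualPairing p.1 (Y p.2) :=
    measurable_dualPairing.comp (measurable_fst.prodMk (hY.comp measurable_snd))
  exact Measurable.stronglyMeasurable (by fun_prop)

lemma stronglyMeasurable_latticeChar {Y : Ω → ℤ × ℤ} (hY : Measurable Y) :
    StronglyMeasurable (latticeChar P Y) :=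
  (stronglyMeasurable_uncurry_exp hY).integral_prod_right

lemma norm_latticeChar_le (Y : Ω → ℤ × ℤ) (t : ℝ × ℝ) : ‖latticeChar P Y t‖ ≤ 1 := by
  have := norm_integral_le_of_norm_le_const (μ := P)
    (f := fun ω => Complex.exp (Complex.I * dualPairing t (Y ω))) (C := 1)
    (.of_forall fun _ => (norm_exp_dualPairing _ _).le)
  simpa [latticeChar] using this

/-- Fourier inversion at the origin: after Fubini, orthogonality of characters leaves only the event
`Y = 0`. -/
lemma setIntegral_latticeChar {Y : Ω → ℤ × ℤ} (hY : Measurable Y) :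
    ∫ t in frequencySquare, latticeChar P Y t =
      ((4 * Real.pi ^ 2 * P.real {ω | Y ω = 0} : ℝ) : ℂ) := by
  unfold latticeChar
  rw [integral_integral_swap]
  · simp_rw [setIntegral_exp_dualPairing]
    have hm : MeasurableSet {ω | Y ω = 0} := hY (measurableSet_singleton 0)
    have : (fun ω => if Y ω = 0 then ((4 * Real.pi ^ 2 : ℝ) : ℂ) else 0) =
        Set.indicator {ω | Y ω = 0} fun _ => ((4 * Real.pi ^ 2 : ℝ) : ℂ) := by
      ext ω; simp [Set.indicator_apply]
    rw [this, integral_indicator_const _ hm]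
    simp [mul_comm]
  · exact .of_bound (stronglyMeasurable_uncurry_exp hY).aestronglyMeasurable 1
      (.of_forall fun _ => (norm_exp_dualPairing _ _).le)

lemma latticeChar_sum {X : ℕ → Ω → ℤ × ℤ} (hX : ∀ i, Measurable (X i)) (hind : iIndepFun X P)
    (hid : ∀ i, IdentDistrib (X i) (X 0) P P) (n : ℕ) (t : ℝ × ℝ) :
    latticeChar P (fun ω => ∑ i ∈ Finset.range n, X i ω) t = latticeChar P (X 0) t ^ n := by
  have hg : Measurable fun x : ℤ × ℤ => Complex.exp (Complex.I * dualPairing t x) :=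
    measurable_of_countable _
  induction n with
  | zero => simp [latticeChar, dualPairing]
  | succ n ih =>
    have hi := (hind.indepFun_sum_range_succ hX n).comp hg hg
    have hS : Measurable fun ω => ∑ i ∈ Finset.range n, X i ω :=
      Finset.measurable_fun_sum _ fun i _ => hX i
    have := hi.integral_fun_mul_eq_mul_integral
      (by
        have := (measurable_exp_dualPairing hS t).aestronglyMeasurable (μ := P)
        convert this using 1
        ext ω; simp)
      (measurable_exp_dualPairing (hX n) t).aestronglyMeasurable
    rw [pow_succ, ← ih]
    have he : latticeChar P (X n) t = latticeChar P (X 0) t :=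
      ((hid n).comp hg).integral_eq
    rw [← he]
    unfold latticeChar
    simp only [Function.comp_apply, Finset.sum_apply] at this
    rw [← this]
    congr 1; ext ω
    simp only
    rw [Finset.sum_range_succ, dualPairing_add, ← Complex.exp_add]
    push_cast; congr 1; ring

end Characteristic

/-! ### Second moments and the characteristic function near the origin -/

section Lattice

variable {Ω : Type*} [MeasurableSpace Ω] {P : Measure Ω}

/-- The second moment of a random lattice point in the direction `t`. -/
noncomputable def directionalMoment (P : Measure Ω) (Y : Ω → ℤ × ℤ) (t : ℝ × ℝ) : ℝ :=
  ∫ ω, dualPairing t (Y ω) ^ 2 ∂P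

lemma directionalMoment_nonneg (Y : Ω → ℤ × ℤ) (t : ℝ × ℝ) : 0 ≤ directionalMoment P Y t :=
  integral_nonneg fun _ => sq_nonneg _

variable {Y : Ω → ℤ × ℤ}

lemma measurable_dualPairing_comp (hY : Measurable Y) (t : ℝ × ℝ) :
    Measurable fun ω => dualPairing t (Y ω) :=
  measurable_dualPairing.comp (measurable_const.prodMk hY)

lemma integrable_dualPairing_sq (hY : Measurable Y)
    (h2 : Integrable (fun ω => ((Y ω).1 : ℝ) ^ 2 + ((Y ω).2 : ℝ) ^ 2) P) (t : ℝ × ℝ) :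
    Integrable (fun ω => dualPairing t (Y ω) ^ 2) P := by
  refine (h2.const_mul (t.1 ^ 2 + t.2 ^ 2)).mono'
    ((measurable_dualPairing_comp hY t).pow_const 2).aestronglyMeasurable (.of_forall fun ω => ?_)
  rw [Real.norm_of_nonneg (sq_nonneg _)]
  exact dualPairing_sq_le t (Y ω)

lemma directionalMoment_le (hY : Measurable Y)
    (h2 : Integrable (fun ω => ((Y ω).1 : ℝ) ^ 2 + ((Y ω).2 : ℝ) ^ 2) P) (t : ℝ × ℝ) :
    directionalMoment P Y t ≤
      (∫ ω, ((Y ω).1 : ℝ) ^ 2 + ((Y ω).2 : ℝ) ^ 2 ∂P) * (t.1 ^ 2 + t.2 ^ 2) := by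
  rw [mul_comm, ← integral_const_mul]
  exact integral_mono (integrable_dualPairing_sq hY h2 t) (h2.const_mul _)
    fun ω => dualPairing_sq_le t (Y ω)

variable [IsProbabilityMeasure P]

/-- The lattice is countable, so if all points violating `p` were null, their union would be null
too. -/
lemma exists_atom_of_not_ae {p : ℤ × ℤ → Prop} (h : ¬ ∀ᵐ ω ∂P, p (Y ω)) :
    ∃ x, ¬ p x ∧ 0 < P.real {ω | Y ω = x} := by
  by_contra! hc
  refine h ?_
  have : ∀ᵐ ω ∂P, ∀ x, ¬ p x → Y ω ≠ x := by
    rw [ae_all_iff]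
    intro x
    by_cases hx : p x
    · simp [hx]
    · have h0 : P.real {ω | Y ω = x} = 0 := le_antisymm (hc x hx) measureReal_nonneg
      rw [measureReal_eq_zero_iff] at h0
      simpa [hx, ae_iff] using h0
  filter_upwards [this] with ω hω
  by_contra hp
  exact hω _ hp rfl

lemma integrable_dualPairing (hY : Measurable Y)
    (h2 : Integrable (fun ω => ((Y ω).1 : ℝ) ^ 2 + ((Y ω).2 : ℝ) ^ 2) P) (t : ℝ × ℝ) :
    Integrable (fun ω => dualPairing t (Y ω)) P := by
  refine ((integrable_const 1).add (integrable_dualPairing_sq hY h2 t)).mono'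
    (measurable_dualPairing_comp hY t).aestronglyMeasurable (.of_forall fun ω => ?_)
  rw [Real.norm_eq_abs, Pi.add_apply, ← sq_abs]
  nlinarith [sq_nonneg (|dualPairing t (Y ω)| - 1), abs_nonneg (dualPairing t (Y ω))]

/-- The zero mean allows the linear Taylor term to be subtracted at no cost, leaving a quadratic
error. -/
lemma norm_one_sub_latticeChar_le (hY : Measurable Y)
    (h2 : Integrable (fun ω => ((Y ω).1 : ℝ) ^ 2 + ((Y ω).2 : ℝ) ^ 2) P)
    (hmean : ∀ t, ∫ ω, dualPairing t (Y ω) ∂P = 0) (t : ℝ × ℝ) :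
    ‖1 - latticeChar P Y t‖ ≤ 2 * directionalMoment P Y t := by
  have hlin : Integrable (fun ω => Complex.I * (dualPairing t (Y ω) : ℂ)) P :=
    (integrable_dualPairing hY h2 t).ofReal.const_mul _
  have hlin0 : ∫ ω, Complex.I * (dualPairing t (Y ω) : ℂ) ∂P = 0 := by
    rw [integral_const_mul, integral_complex_ofReal, hmean t]; simp
  have he := integrable_exp_dualPairing (P := P) hY t
  have hkey : latticeChar P Y t - 1 = ∫ ω, (Complex.exp (Complex.I * dualPairing t (Y ω)) - 1 -
      Complex.I * dualPairing t (Y ω)) ∂P := by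
    have h1 := integral_sub (he.sub (integrable_const 1)) hlin
    simp only [Pi.sub_apply] at h1
    rw [h1, hlin0, integral_sub he (integrable_const 1)]
    simp [latticeChar]
  rw [norm_sub_rev, hkey, directionalMoment, ← integral_const_mul]
  exact norm_integral_le_of_norm_le ((integrable_dualPairing_sq hY h2 t).const_mul 2)
    (.of_forall fun ω => norm_exp_I_mul_sub_one_sub_le _)

lemma re_one_sub_latticeChar (hY : Measurable Y) (t : ℝ × ℝ) :
    (1 - latticeChar P Y t).re = ∫ ω, (1 - Real.cos (dualPairing t (Y ω))) ∂P := by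
  have he := integrable_exp_dualPairing (P := P) hY t
  have h1 : 1 - latticeChar P Y t =
      ∫ ω, (1 - Complex.exp (Complex.I * dualPairing t (Y ω))) ∂P := by
    rw [integral_sub (integrable_const 1) he]; simp [latticeChar]
  rw [h1]
  have := integral_re ((integrable_const (1 : ℂ)).sub he)
  simp only [RCLike.re_to_complex, Pi.sub_apply] at this
  rw [← this]
  congr 1; ext ω
  rw [Complex.sub_re, Complex.one_re, mul_comm, Complex.exp_ofReal_mul_I_re]

lemma re_one_sub_latticeChar_nonneg (hY : Measurable Y) (t : ℝ × ℝ) :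
    0 ≤ (1 - latticeChar P Y t).re := by
  rw [re_one_sub_latticeChar hY]
  exact integral_nonneg fun ω => by simpa using Real.cos_le_one _

/-- The real part is the mean of the nonnegative `1 - cos`, so it dominates the contribution of one
atom. There `1 - cos u ≥ 2 u² / π²` applies, since `δ` forces `|u| ≤ π`. -/
lemma exists_atom_bound (hY : Measurable Y) (x : ℤ × ℤ) (hx : 0 < P.real {ω | Y ω = x}) :
    ∃ c > 0, ∃ δ > 0, ∀ t : ℝ × ℝ, |t.1| ≤ δ → |t.2| ≤ δ →
      c * dualPairing t x ^ 2 ≤ (1 - latticeChar P Y t).re := by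
  refine ⟨P.real {ω | Y ω = x} * (2 / Real.pi ^ 2), by positivity,
    Real.pi / (1 + |(x.1 : ℝ)| + |(x.2 : ℝ)|), by positivity, fun t h1 h2 => ?_⟩
  have hle : |dualPairing t x| ≤ Real.pi := by
    have := abs_add_le (t.1 * (x.1 : ℝ)) (t.2 * x.2)
    rw [abs_mul, abs_mul] at this
    refine this.trans ?_
    set s := 1 + |(x.1 : ℝ)| + |(x.2 : ℝ)| with hs
    have hp : 0 < Real.pi / s := by positivity
    have b1 := mul_le_mul_of_nonneg_right h1 (abs_nonneg (x.1 : ℝ))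
    have b2 := mul_le_mul_of_nonneg_right h2 (abs_nonneg (x.2 : ℝ))
    have : Real.pi = Real.pi / s * s := (div_mul_cancel₀ _ (by positivity)).symm
    rw [hs] at this
    nlinarith
  have hm : MeasurableSet {ω | Y ω = x} := hY (measurableSet_singleton x)
  rw [re_one_sub_latticeChar hY]
  have hcos := Real.cos_le_one_sub_mul_cos_sq hle
  have hint : Integrable (fun ω => 1 - Real.cos (dualPairing t (Y ω))) P := by
    refine .of_bound (C := 2) ?_ (.of_forall fun ω => ?_)
    · have := measurable_dualPairing_comp hY t
      exact Measurable.aestronglyMeasurable (by fun_prop)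
    · rw [Real.norm_eq_abs, abs_le]
      constructor <;> linarith [Real.cos_le_one (dualPairing t (Y ω)),
        Real.neg_one_le_cos (dualPairing t (Y ω))]
  calc _ ≤ P.real {ω | Y ω = x} * (1 - Real.cos (dualPairing t x)) := by
        rw [mul_assoc]
        exact mul_le_mul_of_nonneg_left (by linarith) hx.le
    _ = ∫ ω in {ω | Y ω = x}, (1 - Real.cos (dualPairing t (Y ω))) ∂P := by
        rw [setIntegral_congr_fun hm (g := fun _ => 1 - Real.cos (dualPairing t x))
          (fun ω hω => by simp only [Set.mem_ofPred_eq] at hω; simp [hω])]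
        simp
    _ ≤ _ := setIntegral_le_integral hint
        (.of_forall fun ω => by simpa using Real.cos_le_one _)

lemma dualPairing_sq_mul_of_parallel (t : ℝ × ℝ) (x y : ℤ × ℤ) (h : x.1 * y.2 = x.2 * y.1) :
    ((x.1 : ℝ) ^ 2 + (x.2 : ℝ) ^ 2) * dualPairing t y ^ 2 =
      ((y.1 : ℝ) ^ 2 + (y.2 : ℝ) ^ 2) * dualPairing t x ^ 2 := by
  have h' : (x.1 : ℝ) * y.2 = x.2 * y.1 := by exact_mod_cast h
  unfold dualPairing
  linear_combination (t.1 ^ 2 * (-(x.1 : ℝ) * y.2 - x.2 * y.1) +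
    t.2 ^ 2 * ((x.1 : ℝ) * y.2 + x.2 * y.1)
    + 2 * t.1 * t.2 * ((x.1 : ℝ) * y.1 - x.2 * y.2)) * h'

lemma one_le_sq_add_sq {x : ℤ × ℤ} (hx : x ≠ 0) : 1 ≤ (x.1 : ℝ) ^ 2 + (x.2 : ℝ) ^ 2 := by
  have : 0 < x.1 ^ 2 + x.2 ^ 2 := by
    by_contra! h
    have h1 : x.1 = 0 := by nlinarith [sq_nonneg x.1, sq_nonneg x.2]
    have h2 : x.2 = 0 := by nlinarith [sq_nonneg x.1, sq_nonneg x.2]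
    exact hx (Prod.ext h1 h2)
  exact_mod_cast this

/-- Cramer's rule recovers `t` from its two pairings, and the nonzero integer determinant has square
at least one. -/
lemma sq_add_sq_le_of_independent (t : ℝ × ℝ) (x y : ℤ × ℤ) (h : x.1 * y.2 ≠ x.2 * y.1) :
    t.1 ^ 2 + t.2 ^ 2 ≤ ((x.1 : ℝ) ^ 2 + (x.2 : ℝ) ^ 2 + (y.1 : ℝ) ^ 2 + (y.2 : ℝ) ^ 2) *
      (dualPairing t x ^ 2 + dualPairing t y ^ 2) := by
  have hD : 1 ≤ ((x.1 : ℝ) * y.2 - x.2 * y.1) ^ 2 := by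
    have : 0 < (x.1 * y.2 - x.2 * y.1) ^ 2 := by
      have := sub_ne_zero.2 h
      positivity
    exact_mod_cast this
  have e1 : t.1 * ((x.1 : ℝ) * y.2 - x.2 * y.1) =
      y.2 * dualPairing t x - x.2 * dualPairing t y := by unfold dualPairing; ring
  have e2 : t.2 * ((x.1 : ℝ) * y.2 - x.2 * y.1) =
      x.1 * dualPairing t y - y.1 * dualPairing t x := by unfold dualPairing; ring
  generalize dualPairing t x = a at *
  generalize dualPairing t y = b at *
  have hs : (t.1 ^ 2 + t.2 ^ 2) * ((x.1 : ℝ) * y.2 - x.2 * y.1) ^ 2 =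
      (y.2 * a - x.2 * b) ^ 2 + (x.1 * b - y.1 * a) ^ 2 := by
    rw [← e1, ← e2]; ring
  calc t.1 ^ 2 + t.2 ^ 2 ≤ (t.1 ^ 2 + t.2 ^ 2) * ((x.1 : ℝ) * y.2 - x.2 * y.1) ^ 2 :=
        le_mul_of_one_le_right (by positivity) hD
    _ ≤ _ := by
        rw [hs]
        nlinarith [sq_nonneg ((y.2 : ℝ) * b + x.2 * a), sq_nonneg ((x.1 : ℝ) * a + y.1 * b)]

/-- Near the origin, the real part of `1 - φ` dominates a multiple of the second moment. -/
lemma exists_directionalMoment_le (hY : Measurable Y)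
    (h2 : Integrable (fun ω => ((Y ω).1 : ℝ) ^ 2 + ((Y ω).2 : ℝ) ^ 2) P) :
    ∃ c > 0, ∃ δ > 0, ∀ t : ℝ × ℝ, |t.1| ≤ δ → |t.2| ≤ δ →
      c * directionalMoment P Y t ≤ (1 - latticeChar P Y t).re := by
  set σ := ∫ ω, ((Y ω).1 : ℝ) ^ 2 + ((Y ω).2 : ℝ) ^ 2 ∂P with hσ
  have hσ0 : 0 ≤ σ := integral_nonneg fun ω => by positivity
  -- The step may be degenerate: its law is concentrated at zero, on a line through zero, or charges
  -- two independent vectors. None, one or two atoms then control the second moment.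
  by_cases h0 : ∀ᵐ ω ∂P, Y ω = 0
  · refine ⟨1, one_pos, 1, one_pos, fun t _ _ => ?_⟩
    have : directionalMoment P Y t = 0 := by
      refine integral_eq_zero_of_ae ?_
      filter_upwards [h0] with ω hω
      simp [hω, dualPairing]
    simpa [this] using re_one_sub_latticeChar_nonneg (P := P) hY t
  obtain ⟨x, hx0, hx⟩ := exists_atom_of_not_ae (p := fun y => y = 0) h0
  obtain ⟨c, hc, δ, hδ, hcx⟩ := exists_atom_bound hY x hx
  by_cases h1 : ∀ᵐ ω ∂P, x.1 * (Y ω).2 = x.2 * (Y ω).1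
  · refine ⟨c / (σ + 1), by positivity, δ, hδ, fun t ht1 ht2 => ?_⟩
    have hq : directionalMoment P Y t ≤ σ * dualPairing t x ^ 2 := by
      rw [hσ, ← integral_mul_const]
      refine integral_mono_ae (integrable_dualPairing_sq hY h2 t) (h2.mul_const _) ?_
      filter_upwards [h1] with ω hω
      rw [← dualPairing_sq_mul_of_parallel t x (Y ω) hω]
      exact le_mul_of_one_le_left (sq_nonneg _) (one_le_sq_add_sq hx0)
    refine le_trans ?_ (hcx t ht1 ht2)
    rw [div_mul_eq_mul_div, div_le_iff₀ (by positivity), mul_assoc]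
    exact mul_le_mul_of_nonneg_left (by nlinarith [sq_nonneg (dualPairing t x)]) hc.le
  · obtain ⟨y, hxy, hy⟩ := exists_atom_of_not_ae (p := fun y => x.1 * y.2 = x.2 * y.1) h1
    obtain ⟨c', hc', δ', hδ', hcy⟩ := exists_atom_bound hY y hy
    set K := (x.1 : ℝ) ^ 2 + (x.2 : ℝ) ^ 2 + (y.1 : ℝ) ^ 2 + (y.2 : ℝ) ^ 2 with hK
    have hK0 : 0 ≤ K := by positivity
    have hm : 0 < min c c' := lt_min hc hc'
    -- The factor 2 comes from adding the two atom bounds; the `+ 1` keeps the denominator positive.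
    refine ⟨min c c' / (2 * (σ * K + 1)), by positivity, min δ δ', lt_min hδ hδ',
      fun t ht1 ht2 => ?_⟩
    have hX := hcx t (ht1.trans (min_le_left _ _)) (ht2.trans (min_le_left _ _))
    have hY' := hcy t (ht1.trans (min_le_right _ _)) (ht2.trans (min_le_right _ _))
    have hq : directionalMoment P Y t ≤
        σ * K * (dualPairing t x ^ 2 + dualPairing t y ^ 2) := by
      rw [mul_assoc]
      exact (directionalMoment_le hY h2 t).trans
        (mul_le_mul_of_nonneg_left (sq_add_sq_le_of_independent t x y hxy) hσ0)
    have a1 := mul_le_mul_of_nonneg_right (min_le_left c c') (sq_nonneg (dualPairing t x))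
    have a2 := mul_le_mul_of_nonneg_right (min_le_right c c') (sq_nonneg (dualPairing t y))
    have a3 : min c c' * (dualPairing t x ^ 2 + dualPairing t y ^ 2) ≤
        2 * (1 - latticeChar P Y t).re := by linarith
    rw [div_mul_eq_mul_div, div_le_iff₀ (by positivity)]
    calc min c c' * directionalMoment P Y t
        ≤ min c c' * (σ * K * (dualPairing t x ^ 2 + dualPairing t y ^ 2)) :=
          mul_le_mul_of_nonneg_left hq hm.le
      _ = σ * K * (min c c' * (dualPairing t x ^ 2 + dualPairing t y ^ 2)) := by ring
      _ ≤ σ * K * (2 * (1 - latticeChar P Y t).re) :=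
          mul_le_mul_of_nonneg_left a3 (by positivity)
      _ ≤ _ := by nlinarith [re_one_sub_latticeChar_nonneg (P := P) hY t]

/-! ### The resolvent and the generating function of returns -/

lemma le_re_one_sub_mul_latticeChar (Y : Ω → ℤ × ℤ) {r : ℝ} (hr0 : 0 ≤ r)
    (t : ℝ × ℝ) : 1 - r ≤ (1 - (r : ℂ) * latticeChar P Y t).re := by
  have h1 := (Complex.re_le_norm _).trans (norm_latticeChar_le (P := P) Y t)
  rw [Complex.sub_re, Complex.re_ofReal_mul, Complex.one_re]
  nlinarith

/-- The lower bound for the resolvent kernel near the origin. -/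
lemma exists_resolvent_bound (hY : Measurable Y)
    (h2 : Integrable (fun ω => ((Y ω).1 : ℝ) ^ 2 + ((Y ω).2 : ℝ) ^ 2) P)
    (hmean : ∀ t, ∫ ω, dualPairing t (Y ω) ∂P = 0) :
    ∃ κ > 0, ∃ C ≥ 0, ∃ δ > 0, ∀ t : ℝ × ℝ, |t.1| ≤ δ → |t.2| ≤ δ →
      ∀ r : ℝ, 1 / 2 ≤ r → r < 1 →
        κ / ((1 - r) + C * (t.1 ^ 2 + t.2 ^ 2)) ≤ ((1 - (r : ℂ) * latticeChar P Y t)⁻¹).re := by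
  obtain ⟨c, hc, δ, hδ, hcδ⟩ := exists_directionalMoment_le hY h2
  set σ := ∫ ω, ((Y ω).1 : ℝ) ^ 2 + ((Y ω).2 : ℝ) ^ 2 ∂P with hσ
  have hσ0 : 0 ≤ σ := integral_nonneg fun ω => by positivity
  -- Put `z = 1 - r φ = (1 - r) + r (1 - φ)` and `w = 1 - r + q`. Then `Re z ≥ m w`, where `c / 2`
  -- reflects `r ≥ 1 / 2`, and `‖z‖ ≤ 2 w`; hence `Re z⁻¹ = Re z / ‖z‖² ≥ m / (4 w)`.
  set m := min 1 (c / 2) with hm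
  have hm0 : 0 < m := lt_min one_pos (by positivity)
  refine ⟨m / 4, by positivity, σ, hσ0, δ, hδ, fun t ht1 ht2 r hr1 hr2 => ?_⟩
  have hq := directionalMoment_le (P := P) hY h2 t
  have hre := hcδ t ht1 ht2
  have hno := norm_one_sub_latticeChar_le (P := P) hY h2 hmean t
  have hq0 := directionalMoment_nonneg (P := P) Y t
  set q := directionalMoment P Y t
  set φ := latticeChar P Y t
  have hz : 1 - (r : ℂ) * φ = ((1 - r : ℝ) : ℂ) + r * (1 - φ) := by push_cast; ring
  have hw : 0 < 1 - r + q := by linarith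
  have hzre : m * (1 - r + q) ≤ (1 - (r : ℂ) * φ).re := by
    rw [hz, Complex.add_re, Complex.ofReal_re, Complex.re_ofReal_mul]
    have b1 : m ≤ 1 := min_le_left _ _
    have b2 : m ≤ c / 2 := min_le_right _ _
    have b3 : m * q ≤ c / 2 * q := mul_le_mul_of_nonneg_right b2 hq0
    have b4 : 1 / 2 * (c * q) ≤ r * (1 - φ).re :=
      mul_le_mul hr1 hre (by positivity) (by linarith)
    nlinarith
  have hznorm : ‖1 - (r : ℂ) * φ‖ ≤ 2 * (1 - r + q) := by
    rw [hz]
    refine (norm_add_le _ _).trans ?_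
    rw [norm_mul, Complex.norm_real, Complex.norm_real, Real.norm_of_nonneg (by linarith),
      Real.norm_of_nonneg (by linarith)]
    nlinarith [norm_nonneg (1 - φ)]
  have hzpos : 0 < (1 - (r : ℂ) * φ).re := lt_of_lt_of_le (by positivity) hzre
  have hnpos : 0 < ‖1 - (r : ℂ) * φ‖ := hzpos.trans_le (Complex.re_le_norm _)
  rw [Complex.inv_re, Complex.normSq_eq_norm_sq]
  calc _ ≤ m / 4 / (1 - r + q) := by
        apply div_le_div_of_nonneg_left (by positivity) hw
        rw [hσ]; linarith
    _ = m * (1 - r + q) / (2 * (1 - r + q)) ^ 2 := by field_simp; norm_num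
    _ ≤ m * (1 - r + q) / ‖1 - (r : ℂ) * φ‖ ^ 2 := by gcongr
    _ ≤ _ := by gcongr

lemma integrableOn_resolvent (hY : Measurable Y) {r : ℝ} (hr0 : 0 ≤ r) (hr : r < 1) :
    IntegrableOn (fun t => (1 - (r : ℂ) * latticeChar P Y t)⁻¹) frequencySquare := by
  refine Integrable.of_bound (C := (1 - r)⁻¹) ?_ (.of_forall fun t => ?_)
  · have := (stronglyMeasurable_latticeChar (P := P) hY).measurable
    exact Measurable.aestronglyMeasurable (by fun_prop)
  · rw [norm_inv]
    exact inv_anti₀ (by linarith)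
      ((le_re_one_sub_mul_latticeChar Y hr0 t).trans (Complex.re_le_norm _))

/-- The resolvent is a geometric series in `r φ`, integrable term by term since `r < 1`. Each `φⁿ`
is the characteristic function of the walk at time `n`, so Fourier inversion applies. -/
lemma hasSum_return_resolvent {X : ℕ → Ω → ℤ × ℤ} (hX : ∀ i, Measurable (X i))
    (hind : iIndepFun X P) (hid : ∀ i, IdentDistrib (X i) (X 0) P P)
    {r : ℝ} (hr0 : 0 ≤ r) (hr : r < 1) :
    HasSum (fun n : ℕ => r ^ n * (4 * Real.pi ^ 2 *
        P.real {ω | ∑ i ∈ Finset.range n, X i ω = 0}))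
      (∫ t in frequencySquare, ((1 - (r : ℂ) * latticeChar P (X 0) t)⁻¹).re) := by
  have hφ := stronglyMeasurable_latticeChar (P := P) (hX 0)
  have hint : ∀ n : ℕ, Integrable (fun t => ((r : ℂ) * latticeChar P (X 0) t) ^ n)
      (volume.restrict frequencySquare) := fun n => by
    refine .of_bound (C := 1) ?_ (.of_forall fun t => ?_)
    · exact (hφ.aestronglyMeasurable.const_mul _).pow n
    · rw [norm_pow, norm_mul, Complex.norm_real, Real.norm_of_nonneg hr0]
      exact pow_le_one₀ (by positivity) (mul_le_one₀ hr.le (norm_nonneg _)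
        (norm_latticeChar_le _ _))
  have hsum := hasSum_integral_of_summable_integral_norm hint (by
    refine Summable.of_nonneg_of_le (fun n => integral_nonneg fun t => norm_nonneg _)
      (fun n => ?_) ((summable_geometric_of_lt_one hr0 hr).mul_left
        ((volume.restrict frequencySquare).real Set.univ))
    have := norm_integral_le_of_norm_le_const (μ := volume.restrict frequencySquare)
      (f := fun t => ‖((r : ℂ) * latticeChar P (X 0) t) ^ n‖) (C := r ^ n)
      (.of_forall fun t => by
        rw [norm_norm, norm_pow, norm_mul, Complex.norm_real, Real.norm_of_nonneg hr0]
        exact pow_le_pow_left₀ (by positivity)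
          (mul_le_of_le_one_right hr0 (norm_latticeChar_le _ _)) n)
    rw [mul_comm]
    exact (Real.le_norm_self _).trans this)
  have hgeo : ∀ t, ∑' n : ℕ, ((r : ℂ) * latticeChar P (X 0) t) ^ n =
      (1 - (r : ℂ) * latticeChar P (X 0) t)⁻¹ := fun t => by
    refine tsum_geometric_of_norm_lt_one ?_
    rw [norm_mul, Complex.norm_real, Real.norm_of_nonneg hr0]
    exact (mul_le_of_le_one_right hr0 (norm_latticeChar_le _ _)).trans_lt hr
  simp_rw [hgeo] at hsum
  have hre := Complex.hasSum_re hsum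
  have hI := integral_re (integrableOn_resolvent (P := P) (hX 0) hr0 hr)
  simp only [RCLike.re_to_complex] at hI
  rw [hI]
  convert hre using 2 with n
  simp_rw [mul_pow]
  rw [integral_const_mul]
  have hS : Measurable fun ω => ∑ i ∈ Finset.range n, X i ω :=
    Finset.measurable_fun_sum _ fun i _ => hX i
  have hL := setIntegral_latticeChar (P := P) hS
  simp_rw [latticeChar_sum hX hind hid] at hL
  rw [hL, ← Complex.ofReal_pow, ← Complex.ofReal_mul, Complex.ofReal_re]

/-! ### Divergence of the expected number of returns -/

/-- The dyadic square of side `δ / 2 ^ (k + 1)` on the diagonal. -/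
def dyadicSquare (δ : ℝ) (k : ℕ) : Set (ℝ × ℝ) :=
  Set.Ioc (δ / 2 ^ (k + 1)) (δ / 2 ^ k) ×ˢ Set.Ioc (δ / 2 ^ (k + 1)) (δ / 2 ^ k)

lemma measurableSet_dyadicSquare (δ : ℝ) (k : ℕ) : MeasurableSet (dyadicSquare δ k) :=
  measurableSet_Ioc.prod measurableSet_Ioc

lemma disjoint_dyadicSquare {δ : ℝ} (hδ : 0 < δ) {j k : ℕ} (h : j < k) :
    Disjoint (dyadicSquare δ j) (dyadicSquare δ k) := by
  rw [Set.disjoint_left]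
  rintro t ⟨ht, -⟩ ⟨ht', -⟩
  have : δ / 2 ^ k ≤ δ / 2 ^ (j + 1) :=
    div_le_div_of_nonneg_left hδ.le (by positivity) (pow_le_pow_right₀ one_le_two h)
  linarith [ht.1, ht'.2]

lemma dyadicSquare_bounds {δ : ℝ} (hδ : 0 < δ) {k : ℕ} {t : ℝ × ℝ} (ht : t ∈ dyadicSquare δ k) :
    0 < t.1 ∧ t.1 ≤ δ / 2 ^ k ∧ 0 < t.2 ∧ t.2 ≤ δ / 2 ^ k ∧ δ / 2 ^ k ≤ δ := by
  have h0 : 0 < δ / 2 ^ (k + 1) := by positivity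
  exact ⟨h0.trans ht.1.1, ht.1.2, h0.trans ht.2.1, ht.2.2,
    div_le_self hδ.le (one_le_pow₀ one_le_two)⟩

lemma volume_real_dyadicSquare {δ : ℝ} (hδ : 0 < δ) (k : ℕ) :
    volume.real (dyadicSquare δ k) = δ ^ 2 / 4 / 4 ^ k := by
  have h : δ / 2 ^ (k + 1) ≤ δ / 2 ^ k :=
    div_le_div_of_nonneg_left hδ.le (by positivity) (pow_le_pow_right₀ one_le_two (by omega))
  rw [dyadicSquare, Measure.volume_eq_prod, measureReal_prod_prod,
    Real.volume_real_Ioc_of_le h, pow_succ, show (4 : ℝ) ^ k = 2 ^ k * 2 ^ k by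
      rw [← mul_pow]; norm_num]
  field_simp; norm_num

/-- The expected number of returns to the origin of a centred planar lattice walk with finite
second moments is infinite. -/
theorem not_summable_return {X : ℕ → Ω → ℤ × ℤ} (hX : ∀ i, Measurable (X i))
    (hind : iIndepFun X P) (hid : ∀ i, IdentDistrib (X i) (X 0) P P)
    (h2 : Integrable (fun ω => ((X 0 ω).1 : ℝ) ^ 2 + ((X 0 ω).2 : ℝ) ^ 2) P)
    (hmean : ∀ t, ∫ ω, dualPairing t (X 0 ω) ∂P = 0) :
    ¬ Summable fun n : ℕ => P.real {ω | ∑ i ∈ Finset.range n, X i ω = 0} := by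
  intro hs
  obtain ⟨κ, hκ, C, hC, δ', hδ', hbound⟩ := exists_resolvent_bound (P := P) (hX 0) h2 hmean
  set δ := min δ' Real.pi with hδdef
  have hδ : 0 < δ := lt_min hδ' Real.pi_pos
  set a := fun n : ℕ => P.real {ω | ∑ i ∈ Finset.range n, X i ω = 0}
  -- Lower bound for the integral over every dyadic square: the area decays like `4⁻ᵏ` while the
  -- kernel grows like `4ᵏ`.
  set m := δ ^ 2 / 4 * (κ / (1 + 2 * C * δ ^ 2)) with hm
  have hm0 : 0 < m := by positivity
  obtain ⟨N, hN⟩ := exists_nat_gt (4 * Real.pi ^ 2 * (∑' n, a n) / m)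
  -- `K` squares contribute at least `K m`, beyond the upper bound. The choice `1 - r = 4⁻ᴷ` lets
  -- the kernel estimate hold on all of them, and `K ≥ 1` ensures `r ≥ 1 / 2`.
  set K := N + 1 with hK
  set r : ℝ := 1 - (4 ^ K)⁻¹ with hr
  have h4 : (4 : ℝ) ≤ 4 ^ K := by
    rw [hK, pow_succ]
    nlinarith [one_le_pow₀ (show (1 : ℝ) ≤ 4 by norm_num) (n := N)]
  have hinv : (4 ^ K : ℝ)⁻¹ ≤ 4⁻¹ := inv_anti₀ (by norm_num) h4
  have hinv0 : 0 < (4 ^ K : ℝ)⁻¹ := by positivity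
  have hr1 : 1 / 2 ≤ r := by rw [hr]; linarith
  have hr2 : r < 1 := by rw [hr]; linarith
  have hsum := hasSum_return_resolvent (P := P) hX hind hid (by linarith) hr2
  set f : ℝ × ℝ → ℝ := fun t => ((1 - (r : ℂ) * latticeChar P (X 0) t)⁻¹).re with hf
  -- This bound does not depend on `r`, because `rⁿ ≤ 1`.
  have hup : ∫ t in frequencySquare, f t ≤ 4 * Real.pi ^ 2 * ∑' n, a n := by
    rw [← hsum.tsum_eq, ← tsum_mul_left]
    refine hsum.summable.tsum_le_tsum (fun n => ?_) (hs.mul_left _)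
    exact mul_le_of_le_one_left (by positivity) (pow_le_one₀ (by linarith) hr2.le)
  have hf0 : ∀ t, 0 ≤ f t := fun t => by
    rw [hf]
    simp only [Complex.inv_re]
    have := le_re_one_sub_mul_latticeChar (P := P) (X 0)
      (r := r) (by linarith) t
    exact div_nonneg (by linarith) (Complex.normSq_nonneg _)
  have hfint : IntegrableOn f frequencySquare :=
    (integrableOn_resolvent (P := P) (hX 0) (by linarith) hr2).re
  have hsub : ∀ k, dyadicSquare δ k ⊆ frequencySquare := fun k t ht => by
    obtain ⟨h1, h2, h3, h4, h5⟩ := dyadicSquare_bounds hδ ht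
    have : δ ≤ Real.pi := min_le_right _ _
    exact ⟨⟨by linarith [Real.pi_pos], by linarith⟩, ⟨by linarith [Real.pi_pos], by linarith⟩⟩
  have hlow : ∀ k ∈ Finset.range K, m ≤ ∫ t in dyadicSquare δ k, f t := fun k hk => by
    have hk' : k ≤ K := (Finset.mem_range.1 hk).le
    have hge : ∀ t ∈ dyadicSquare δ k, κ / (1 + 2 * C * δ ^ 2) * 4 ^ k ≤ f t := fun t ht => by
      obtain ⟨h1, h2, h3, h4, h5⟩ := dyadicSquare_bounds hδ ht
      have hδle : δ ≤ δ' := min_le_left _ _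
      refine le_trans ?_ (hbound t (by rw [abs_of_pos h1]; linarith)
        (by rw [abs_of_pos h3]; linarith) r hr1 hr2)
      have e4 : (4 : ℝ) ^ k = (2 ^ k) ^ 2 := by rw [← pow_mul, mul_comm, pow_mul]; norm_num
      have q1 : t.1 ^ 2 ≤ δ ^ 2 / 4 ^ k := by
        rw [e4, ← div_pow]; exact pow_le_pow_left₀ h1.le h2 2
      have q2 : t.2 ^ 2 ≤ δ ^ 2 / 4 ^ k := by
        rw [e4, ← div_pow]; exact pow_le_pow_left₀ h3.le h4 2
      have q3 : 1 - r ≤ 1 / 4 ^ k := by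
        rw [hr, sub_sub_cancel, one_div]
        exact inv_anti₀ (by positivity) (pow_le_pow_right₀ (by norm_num) hk')
      have q4 : (1 - r) + C * (t.1 ^ 2 + t.2 ^ 2) ≤ (1 + 2 * C * δ ^ 2) / 4 ^ k := by
        calc _ ≤ 1 / 4 ^ k + C * (δ ^ 2 / 4 ^ k + δ ^ 2 / 4 ^ k) := by gcongr
          _ = _ := by ring
      calc κ / (1 + 2 * C * δ ^ 2) * 4 ^ k = κ / ((1 + 2 * C * δ ^ 2) / 4 ^ k) := by
            field_simp
        _ ≤ _ := div_le_div_of_nonneg_left hκ.le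
            (add_pos_of_pos_of_nonneg (by linarith) (by positivity)) q4
    have hfin : volume (dyadicSquare δ k) ≠ ⊤ :=
      ((measure_mono (hsub k)).trans_lt volume_frequencySquare_lt_top).ne
    have := setIntegral_mono_on (μ := volume) (integrableOn_const hfin)
      (hfint.mono_set (hsub k)) (measurableSet_dyadicSquare δ k) hge
    rw [setIntegral_const, volume_real_dyadicSquare hδ, smul_eq_mul] at this
    refine le_of_eq_of_le ?_ this
    rw [hm]; field_simp
  have hunion : ∑ k ∈ Finset.range K, ∫ t in dyadicSquare δ k, f t ≤
      ∫ t in frequencySquare, f t := by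
    rw [← integral_biUnion_finset _ (fun k _ => measurableSet_dyadicSquare δ k)
      (fun j _ k _ hjk => ?_) (fun k _ => hfint.mono_set (hsub k))]
    · exact setIntegral_mono_set hfint (.of_forall hf0)
        (LE.le.eventuallyLE (Set.iUnion₂_subset fun k _ => hsub k))
    · rcases lt_or_gt_of_ne hjk with h | h
      · exact disjoint_dyadicSquare hδ h
      · exact (disjoint_dyadicSquare hδ h).symm
  have hKm := (Finset.card_nsmul_le_sum _ _ _ hlow).trans (hunion.trans hup)
  rw [Finset.card_range, nsmul_eq_mul] at hKm
  rw [div_lt_iff₀ hm0] at hN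
  rw [hK] at hKm
  push_cast at hKm
  nlinarith

end Lattice

/-! ### From infinitely many expected returns to recurrence -/

section Returns

variable {Ω : Type*} [MeasurableSpace Ω] {P : Measure Ω}
  {X : ℕ → Ω → ℤ × ℤ}

/-- The sequences of steps whose walk never comes back to the origin. -/
def noReturn : Set (ℕ → ℤ × ℤ) := {x | ∀ m : ℕ, ∑ i ∈ Finset.range (m + 1), x i ≠ 0}

lemma noReturn_eq_iInter :
    noReturn = ⋂ m : ℕ, (fun x => ∑ i ∈ Finset.range (m + 1), x i) ⁻¹' {0}ᶜ := by
  ext x; simp [noReturn]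

lemma measurableSet_noReturn : MeasurableSet noReturn := by
  rw [noReturn_eq_iInter]
  exact .iInter fun m => (Finset.measurable_fun_sum _ fun i _ => measurable_pi_apply i)
    (measurableSet_singleton 0).compl

/-- Both laws are the infinite product of the same marginals. -/
lemma map_shift_eq (hX : ∀ i, Measurable (X i)) (hind : iIndepFun X P)
    (hid : ∀ i, IdentDistrib (X i) (X 0) P P) (n : ℕ) :
    P.map (fun ω i => X (n + i) ω) = P.map (fun ω i => X i ω) := by
  rw [iIndepFun.map_fun_eq_infinitePi_map hX hind,
    iIndepFun.map_fun_eq_infinitePi_map (X := fun i => X (n + i)) (fun i => hX _)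
      (hind.precomp (add_right_injective n))]
  congr 1; ext1 i
  rw [(hid (n + i)).map_eq, (hid i).map_eq]

/-- The first event depends on the steps before `n`, the second on those from `n` on; shift
invariance removes `n` from the second factor. -/
lemma measureReal_lastExit (hX : ∀ i, Measurable (X i)) (hind : iIndepFun X P)
    (hid : ∀ i, IdentDistrib (X i) (X 0) P P) (n : ℕ) :
    P.real ({ω | ∑ i ∈ Finset.range n, X i ω = 0} ∩ {ω | (fun i => X (n + i) ω) ∈ noReturn}) =
      P.real {ω | ∑ i ∈ Finset.range n, X i ω = 0} *
        P.real {ω | (fun i => X i ω) ∈ noReturn} := by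
  have hmap : P {ω | (fun i => X (n + i) ω) ∈ noReturn} = P {ω | (fun i => X i ω) ∈ noReturn} := by
    have h := congrArg (fun ν => ν noReturn) (map_shift_eq hX hind hid n)
    rwa [Measure.map_apply (measurable_pi_lambda _ fun i => hX _) measurableSet_noReturn,
      Measure.map_apply (measurable_pi_lambda _ hX) measurableSet_noReturn] at h
  have hI := indep_iSup_of_disjoint (fun i => (hX i).comap_le) hind.iIndep
    (S := Set.Iio n) (T := Set.Ici n) (by
      rw [Set.disjoint_left]
      intro i h1 h2
      exact (Set.mem_Iio.1 h1).not_ge (Set.mem_Ici.1 h2))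
  have hA : MeasurableSet[⨆ i ∈ Set.Iio n, MeasurableSpace.comap (X i) inferInstance]
      {ω | ∑ i ∈ Finset.range n, X i ω = 0} := by
    have : Measurable[⨆ i ∈ Set.Iio n, MeasurableSpace.comap (X i) inferInstance]
        fun ω => ∑ i ∈ Finset.range n, X i ω :=
      Finset.measurable_fun_sum _ fun i hi => (comap_measurable (X i)).mono
        (le_iSup₂_of_le i (Finset.mem_range.1 hi) le_rfl) le_rfl
    exact this (measurableSet_singleton 0)
  have hB : MeasurableSet[⨆ i ∈ Set.Ici n, MeasurableSpace.comap (X i) inferInstance]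
      {ω | (fun i => X (n + i) ω) ∈ noReturn} := by
    have : Measurable[⨆ i ∈ Set.Ici n, MeasurableSpace.comap (X i) inferInstance]
        fun ω i => X (n + i) ω :=
      @measurable_pi_lambda _ _ _ (_) _ _ fun i => (comap_measurable (X (n + i))).mono
        (le_iSup₂_of_le (n + i) (Set.mem_Ici.2 (Nat.le_add_right n i)) le_rfl) le_rfl
    exact this measurableSet_noReturn
  have := (Indep_iff _ _ P).1 hI _ _ hA hB
  rw [measureReal_def, this, ENNReal.toReal_mul, hmap]
  rfl

variable [IsProbabilityMeasure P]

/-- If the expected number of returns is infinite, then the walk returns infinitely often. -/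
theorem ae_frequently_return_of_not_summable (hX : ∀ i, Measurable (X i))
    (hind : iIndepFun X P) (hid : ∀ i, IdentDistrib (X i) (X 0) P P)
    (hs : ¬ Summable fun n : ℕ => P.real {ω | ∑ i ∈ Finset.range n, X i ω = 0}) :
    ∀ᵐ ω ∂P, ∃ᶠ n : ℕ in atTop, ∑ i ∈ Finset.range n, X i ω = 0 := by
  -- In `A n` the last visit to the origin happens at time `n`. These events are disjoint, so their
  -- probabilities are summable; the divergent factor then forces the probability of no return to
  -- vanish.
  set A : ℕ → Set Ω := fun n => {ω | ∑ i ∈ Finset.range n, X i ω = 0} ∩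
    {ω | (fun i => X (n + i) ω) ∈ noReturn} with hA
  have hAm : ∀ n, MeasurableSet (A n) := fun n =>
    ((Finset.measurable_fun_sum _ fun i _ => hX i) (measurableSet_singleton 0)).inter
      ((measurable_pi_lambda _ fun i => hX (n + i)) measurableSet_noReturn)
  have hlt : ∀ {j k : ℕ}, j < k → Disjoint (A j) (A k) := fun {j k} hjk => by
    rw [Set.disjoint_left]
    rintro ω ⟨h1, h2⟩ ⟨h3, -⟩
    obtain ⟨m, rfl⟩ := Nat.exists_eq_add_of_lt hjk
    refine h2 m ?_
    have h3' : ∑ i ∈ Finset.range (j + (m + 1)), X i ω = 0 := h3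
    rwa [Finset.sum_range_add, show ∑ i ∈ Finset.range j, X i ω = 0 from h1, zero_add] at h3'
  have hdisj : Pairwise (Function.onFun Disjoint A) := fun j k hjk => by
    rcases lt_or_gt_of_ne hjk with h | h
    · exact hlt h
    · exact (hlt h).symm
  have hsum : Summable fun n => P.real (A n) := by
    refine ENNReal.summable_toReal ?_
    rw [← measure_iUnion hdisj hAm]
    exact measure_ne_top P _
  have hA' : ∀ n, P.real (A n) = P.real {ω | ∑ i ∈ Finset.range n, X i ω = 0} *
      P.real {ω | (fun i => X i ω) ∈ noReturn} := measureReal_lastExit hX hind hid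
  have hp : P.real {ω | (fun i => X i ω) ∈ noReturn} = 0 := by
    by_contra hp
    simp_rw [hA'] at hsum
    exact hs ((summable_mul_right_iff hp).1 hsum)
  have hnull : ∀ᵐ ω ∂P, ∀ n, ω ∉ A n := ae_all_iff.2 fun n => by
    rw [← measure_eq_zero_iff_ae_notMem, ← measureReal_eq_zero_iff, hA', hp, mul_zero]
  filter_upwards [hnull] with ω hω
  rw [frequently_atTop]
  intro N
  -- The empty sum is a visit at time 0, and every visit is followed by a later one.
  induction N with
  | zero => exact ⟨0, le_rfl, by simp⟩
  | succ N ih =>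
    obtain ⟨n, hn, h0⟩ := ih
    have : ¬ (fun i => X (n + i) ω) ∈ noReturn := fun h => hω n ⟨h0, h⟩
    simp only [noReturn, Set.mem_ofPred_eq, not_forall, not_not] at this
    obtain ⟨m, hm⟩ := this
    exact ⟨n + (m + 1), by omega, by rw [Finset.sum_range_add, h0, hm, add_zero]⟩

/-- Centred planar lattice walks with finite second moments are recurrent. -/
theorem ae_frequently_return (hX : ∀ i, Measurable (X i))
    (hind : iIndepFun X P) (hid : ∀ i, IdentDistrib (X i) (X 0) P P)
    (h2 : Integrable (fun ω => ((X 0 ω).1 : ℝ) ^ 2 + ((X 0 ω).2 : ℝ) ^ 2) P)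
    (hmean : ∀ t, ∫ ω, dualPairing t (X 0 ω) ∂P = 0) :
    ∀ᵐ ω ∂P, ∃ᶠ n : ℕ in atTop, ∑ i ∈ Finset.range n, X i ω = 0 :=
  ae_frequently_return_of_not_summable hX hind hid (not_summable_return hX hind hid h2 hmean)

end Returns

/-! ### Sample weights on a locally finite graph -/

section Graph

variable {V : Type*} {G : SimpleGraph V}

/-- The second vertex of a geodesic to `v` is one step closer, so a ball is covered by `v` and the
finite neighbourhoods of points of the smaller ball. -/
lemma finite_setOf_dist_le [G.LocallyFinite] (hconn : G.Connected) (v : V) (n : ℕ) :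
    {u | G.dist u v ≤ n}.Finite := by
  induction n with
  | zero =>
    refine (Set.finite_singleton v).subset fun u hu => ?_
    exact hconn.dist_eq_zero_iff.1 (Nat.le_zero.1 hu)
  | succ n ih =>
    refine ((Set.finite_singleton v).union
      (ih.biUnion fun w _ => Set.toFinite (G.neighborSet w))).subset fun u hu => ?_
    obtain ⟨p, hp⟩ := hconn.exists_walk_length_eq_dist u v
    cases p with
    | nil => exact Or.inl rfl
    | @cons _ w _ h q =>
      right
      have hu' : G.dist u v ≤ n + 1 := hu
      rw [SimpleGraph.Walk.length_cons] at hp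
      have := SimpleGraph.dist_le q
      exact Set.mem_biUnion (show G.dist w v ≤ n by omega) h.symm

lemma countable_of_connected [G.LocallyFinite] (hconn : G.Connected) : Countable V := by
  obtain ⟨v⟩ := hconn.nonempty
  rw [← Set.countable_univ_iff]
  have : (Set.univ : Set V) = ⋃ n : ℕ, {u | G.dist u v ≤ n} := by
    ext u; simpa using ⟨_, le_refl (G.dist u v)⟩
  rw [this]
  exact Set.countable_iUnion fun n => (finite_setOf_dist_le hconn v n).countable

lemma relFreq_eq_sum [DecidableEq V] (x : ℕ → V) (n : ℕ) (u : V) :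
    relFreq x n u = (∑ i ∈ Finset.range n, if u = x i then (1 : ℝ) else 0) / n := by
  have : {i : ℕ | i < n ∧ x i = u} = ((Finset.range n).filter fun i => u = x i : Finset ℕ) := by
    ext i; simp [eq_comm]
  rw [relFreq, this, Set.ncard_coe_finset, Finset.sum_boole]

lemma weight_relFreq (x : ℕ → V) (n : ℕ) (v : V) :
    weight G (relFreq x n) v = (∑ i ∈ Finset.range n, (G.dist v (x i) : ℝ) ^ 2) / n := by
  classical
  have h : ∀ i ∈ Finset.range n, HasSum
      (fun s => if s = x i then (G.dist v s : ℝ) ^ 2 else 0) ((G.dist v (x i) : ℝ) ^ 2) :=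
    fun i _ => by
      have := hasSum_ite_eq (x i) ((G.dist v (x i) : ℝ) ^ 2)
      convert this using 2 with s
      split_ifs with hs <;> simp [hs]
  rw [weight, ← ((hasSum_sum h).div_const (n : ℝ)).tsum_eq]
  congr 1; ext s
  rw [relFreq_eq_sum, mul_div_assoc', Finset.mul_sum]
  simp

/-- Average over the sample the triangle inequality combined with `(a + b)² ≤ 2 (a² + b²)`. This
makes distant vertices heavy uniformly. -/
lemma half_sq_dist_sub_le_weight (hconn : G.Connected) (x : ℕ → V) {n : ℕ} (hn : 0 < n)
    (u v : V) : (G.dist u v : ℝ) ^ 2 / 2 - weight G (relFreq x n) v ≤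
      weight G (relFreq x n) u := by
  have hn' : (0 : ℝ) < n := by exact_mod_cast hn
  rw [sub_le_iff_le_add, weight_relFreq, weight_relFreq, ← add_div, le_div_iff₀ hn',
    ← Finset.sum_add_distrib]
  have : ∀ i ∈ Finset.range n, (G.dist u v : ℝ) ^ 2 / 2 ≤
      (G.dist u (x i) : ℝ) ^ 2 + (G.dist v (x i) : ℝ) ^ 2 := fun i _ => by
    have h : (G.dist u v : ℝ) ≤ G.dist u (x i) + G.dist v (x i) := by
      have := hconn.dist_triangle (u := u) (v := x i) (w := v)
      rw [G.dist_comm (u := x i)] at this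
      exact_mod_cast this
    have h0 : (0 : ℝ) ≤ G.dist u v := Nat.cast_nonneg _
    nlinarith [sq_nonneg ((G.dist u (x i) : ℝ) - G.dist v (x i))]
  have := Finset.card_nsmul_le_sum _ _ _ this
  rw [Finset.card_range, nsmul_eq_mul] at this
  linarith

/-- Along a sequence whose sample weights converge pointwise, the vertices outside the mean-set
are eventually all heavier than a given vertex of the mean-set. -/
lemma eventually_weight_lt [G.LocallyFinite] (hconn : G.Connected) {μ : V → ℝ} {x : ℕ → V}
    (hT : ∀ v, Tendsto (fun n => weight G (relFreq x n) v) atTop (nhds (weight G μ v)))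
    {v : V} (hv : v ∈ meanSet G μ) :
    ∀ᶠ n in atTop, ∀ u ∉ meanSet G μ, weight G (relFreq x n) v < weight G (relFreq x n) u := by
  -- Beyond distance `R`, half the squared distance to `v` exceeds twice the eventual bound `weight
  -- G μ v + 1`. Pointwise convergence is then needed only on a finite ball.
  obtain ⟨R, hR⟩ := exists_nat_gt (4 * (weight G μ v + 1))
  have hev : ∀ᶠ n in atTop, weight G (relFreq x n) v < weight G μ v + 1 :=
    (hT v).eventually_lt_const (by linarith)
  have hfin : ∀ᶠ n in atTop, ∀ u ∈ {u | G.dist u v ≤ R} \ meanSet G μ,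
      weight G (relFreq x n) v < weight G (relFreq x n) u := by
    refine (eventually_all_finite ((finite_setOf_dist_le hconn v R).sdiff)).2 fun u hu => ?_
    refine (hT v).eventually_lt (hT u) ?_
    by_contra! h
    exact hu.2 fun w => h.trans (hv w)
  filter_upwards [hev, hfin, eventually_gt_atTop 0] with n h1 h2 hn u hu
  by_cases hd : G.dist u v ≤ R
  · exact h2 u ⟨hd, hu⟩
  · have h3 := half_sq_dist_sub_le_weight hconn x hn u v
    have h4 : (R : ℝ) + 1 ≤ G.dist u v := by exact_mod_cast not_le.1 hd
    have h5 : (0 : ℝ) ≤ R := Nat.cast_nonneg R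
    nlinarith

lemma mem_limsup_iff_frequently {s : ℕ → Set V} {v : V} :
    v ∈ limsup s atTop ↔ ∃ᶠ n in atTop, v ∈ s n := by
  rw [limsup_eq_iInf_iSup_of_nat, frequently_atTop]
  simp

/-- Repetition is allowed, so both cardinalities lead to a planar walk; a repeated vertex merely
confines it to the diagonal. -/
lemma exists_enum_of_encard_le_three {s : Set V} (h2 : 2 ≤ s.encard) (h3 : s.encard ≤ 3) :
    ∃ v : Fin 3 → V, s = Set.range v := by
  obtain ⟨k, hk⟩ := ENat.ne_top_iff_exists.1 (ne_top_of_le_ne_top (by decide) h3)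
  rw [← hk] at h2 h3
  have h2' : 2 ≤ k := by exact_mod_cast h2
  have h3' : k ≤ 3 := by exact_mod_cast h3
  interval_cases k
  · obtain ⟨a, b, -, rfl⟩ := Set.encard_eq_two.1 hk.symm
    exact ⟨![a, b, b], by ext; simp [eq_comm]; tauto⟩
  · obtain ⟨a, b, c, -, -, -, rfl⟩ := Set.encard_eq_three.1 hk.symm
    exact ⟨![a, b, c], by ext; simp [eq_comm]; tauto⟩

/-! ### The walk of squared-distance differences -/

/-- The difference of the squared distances to two vertices. -/
noncomputable def sqDistDiff (G : SimpleGraph V) (v w s : V) : ℤ :=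
  (G.dist w s : ℤ) ^ 2 - (G.dist v s : ℤ) ^ 2

/-- Factor `a² - b² = (a - b)(a + b)` with `|a - b| ≤ d(v, w)`. Finite weights thus give the steps
finite second moments, without fourth moments of the distance. -/
lemma sqDistDiff_sq_le (hconn : G.Connected) (v w s : V) :
    (sqDistDiff G v w s : ℝ) ^ 2 ≤
      2 * (G.dist v w : ℝ) ^ 2 * ((G.dist w s : ℝ) ^ 2 + (G.dist v s : ℝ) ^ 2) := by
  have h1 : (G.dist w s : ℝ) ≤ G.dist v w + G.dist v s := by
    have := hconn.dist_triangle (u := w) (v := v) (w := s)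
    rw [G.dist_comm (u := w) (v := v)] at this
    exact_mod_cast this
  have h2 : (G.dist v s : ℝ) ≤ G.dist v w + G.dist w s := by
    exact_mod_cast hconn.dist_triangle (u := v) (v := w) (w := s)
  simp only [sqDistDiff, Int.cast_sub, Int.cast_pow, Int.cast_natCast]
  generalize (G.dist w s : ℝ) = a at *
  generalize (G.dist v s : ℝ) = b at *
  have hd : (a - b) ^ 2 ≤ (G.dist v w : ℝ) ^ 2 :=
    sq_le_sq' (by linarith) (by linarith)
  calc (a ^ 2 - b ^ 2) ^ 2 = (a - b) ^ 2 * (a + b) ^ 2 := by ring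
    _ ≤ (G.dist v w : ℝ) ^ 2 * (2 * (a ^ 2 + b ^ 2)) :=
        mul_le_mul hd (by nlinarith [sq_nonneg (a - b)]) (sq_nonneg _) (sq_nonneg _)
    _ = _ := by ring

section Random

variable [MeasurableSpace V] [MeasurableSingletonClass V]
  {Ω : Type*} [MeasurableSpace Ω] {P : Measure Ω}

lemma map_real_singleton {ξ : Ω → V} (hξ : Measurable ξ) (s : V) :
    (P.map ξ).real {s} = vertexMeasure P ξ s := by
  rw [map_measureReal_apply hξ (measurableSet_singleton s)]; rfl

variable [Countable V] [IsProbabilityMeasure P]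

lemma integrable_dist_sq {ξ : Ω → V} (hξ : Measurable ξ) {v : V}
    (h : WeightDefinedAt G (vertexMeasure P ξ) v) :
    Integrable (fun ω => (G.dist v (ξ ω) : ℝ) ^ 2) P := by
  have hm : Measurable fun s : V => (G.dist v s : ℝ) ^ 2 := measurable_of_countable _
  have hprob : IsProbabilityMeasure (P.map ξ) := Measure.isProbabilityMeasure_map hξ.aemeasurable
  refine (integrable_map_measure hm.aestronglyMeasurable hξ.aemeasurable).1
    ⟨hm.aestronglyMeasurable, ?_⟩
  rw [hasFiniteIntegral_iff_ofReal (.of_forall fun s => by positivity), lintegral_countable']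
  have : ∀ s, ENNReal.ofReal ((G.dist v s : ℝ) ^ 2) * P.map ξ {s} =
      ENNReal.ofReal ((G.dist v s : ℝ) ^ 2 * vertexMeasure P ξ s) := fun s => by
    rw [ENNReal.ofReal_mul (by positivity), ← map_real_singleton hξ, ofReal_measureReal]
  simp_rw [this]
  exact h.tsum_ofReal_lt_top

lemma integral_dist_sq {ξ : Ω → V} (hξ : Measurable ξ) {v : V}
    (h : WeightDefinedAt G (vertexMeasure P ξ) v) :
    ∫ ω, (G.dist v (ξ ω) : ℝ) ^ 2 ∂P = weight G (vertexMeasure P ξ) v := by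
  have hm : Measurable fun s : V => (G.dist v s : ℝ) ^ 2 := measurable_of_countable _
  have hi := (integrable_map_measure (μ := P) hm.aestronglyMeasurable hξ.aemeasurable).2
    (integrable_dist_sq hξ h)
  have hprob : IsProbabilityMeasure (P.map ξ) := Measure.isProbabilityMeasure_map hξ.aemeasurable
  rw [← integral_map hξ.aemeasurable hm.aestronglyMeasurable, integral_countable hi, weight]
  congr 1; ext s
  rw [map_real_singleton hξ, smul_eq_mul, mul_comm]

variable {ξ : ℕ → Ω → V}

lemma ae_tendsto_weight_relFreq (hmeas : ∀ i, Measurable (ξ i)) (hindep : iIndepFun ξ P)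
    (hident : ∀ i, IdentDistrib (ξ i) (ξ 0) P P)
    (htotal : WeightTotallyDefined G (vertexMeasure P (ξ 0))) :
    ∀ᵐ ω ∂P, ∀ v, Tendsto (fun n => weight G (relFreq (fun i => ξ i ω) n) v) atTop
      (nhds (weight G (vertexMeasure P (ξ 0)) v)) := by
  refine ae_all_iff.2 fun v => ?_
  have hm : Measurable fun s : V => (G.dist v s : ℝ) ^ 2 := measurable_of_countable _
  have := strong_law_ae_real (μ := P) (fun i ω => (G.dist v (ξ i ω) : ℝ) ^ 2)
    (integrable_dist_sq (hmeas 0) (htotal v))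
    (fun i j hij => (hindep.indepFun hij).comp hm hm) (fun i => (hident i).comp hm)
  simp_rw [weight_relFreq]
  rwa [integral_dist_sq (hmeas 0) (htotal v)] at this

/-- Three vertices of the mean-set have equal sample weights infinitely often. -/
lemma ae_frequently_weight_eq (hconn : G.Connected) (hmeas : ∀ i, Measurable (ξ i))
    (hindep : iIndepFun ξ P) (hident : ∀ i, IdentDistrib (ξ i) (ξ 0) P P)
    (htotal : WeightTotallyDefined G (vertexMeasure P (ξ 0))) {v w₁ w₂ : V}
    (hv : v ∈ meanSet G (vertexMeasure P (ξ 0))) (hw₁ : w₁ ∈ meanSet G (vertexMeasure P (ξ 0)))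
    (hw₂ : w₂ ∈ meanSet G (vertexMeasure P (ξ 0))) :
    ∀ᵐ ω ∂P, ∃ᶠ n in atTop,
      weight G (relFreq (fun i => ξ i ω) n) w₁ = weight G (relFreq (fun i => ξ i ω) n) v ∧
      weight G (relFreq (fun i => ξ i ω) n) w₂ = weight G (relFreq (fun i => ξ i ω) n) v := by
  set g : V → ℤ × ℤ := fun s => (sqDistDiff G v w₁ s, sqDistDiff G v w₂ s) with hg
  have hgm : Measurable g := measurable_of_countable _
  have hint := fun u => integrable_dist_sq (G := G) (hmeas 0) (htotal u)
  have hsq : ∀ w, Integrable (fun ω => (sqDistDiff G v w (ξ 0 ω) : ℝ) ^ 2) P := fun w => by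
    have hm : Measurable fun s : V => (sqDistDiff G v w s : ℝ) ^ 2 := measurable_of_countable _
    refine (((hint w).add (hint v)).const_mul (2 * (G.dist v w : ℝ) ^ 2)).mono'
      (hm.comp (hmeas 0)).aestronglyMeasurable (.of_forall fun ω => ?_)
    rw [Real.norm_of_nonneg (sq_nonneg _)]
    exact sqDistDiff_sq_le hconn v w (ξ 0 ω)
  have hint1 : ∀ w, Integrable (fun ω => (sqDistDiff G v w (ξ 0 ω) : ℝ)) P := fun w => by
    simp only [sqDistDiff, Int.cast_sub, Int.cast_pow, Int.cast_natCast]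
    exact (hint w).sub (hint v)
  -- The walk is centred because both weights are minimal, hence equal.
  have hmean1 : ∀ w ∈ meanSet G (vertexMeasure P (ξ 0)),
      ∫ ω, (sqDistDiff G v w (ξ 0 ω) : ℝ) ∂P = 0 := fun w hw => by
    simp only [sqDistDiff, Int.cast_sub, Int.cast_pow, Int.cast_natCast]
    rw [integral_sub (hint w) (hint v), integral_dist_sq (hmeas 0) (htotal w),
      integral_dist_sq (hmeas 0) (htotal v), sub_eq_zero]
    exact le_antisymm (hw v) (hv w)
  have := ae_frequently_return (P := P) (X := fun i => g ∘ ξ i) (fun i => hgm.comp (hmeas i))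
    (hindep.comp (fun _ => g) fun _ => hgm) (fun i => (hident i).comp hgm)
    ((hsq w₁).add (hsq w₂)) (fun t => by
      simp only [dualPairing, Function.comp_apply, hg]
      rw [integral_add ((hint1 w₁).const_mul _) ((hint1 w₂).const_mul _), integral_const_mul,
        integral_const_mul, hmean1 w₁ hw₁, hmean1 w₂ hw₂]
      simp)
  filter_upwards [this] with ω hω
  refine hω.mono fun n hn => ?_
  have key : ∀ w, ∑ i ∈ Finset.range n, sqDistDiff G v w (ξ i ω) = 0 →
      weight G (relFreq (fun i => ξ i ω) n) w = weight G (relFreq (fun i => ξ i ω) n) v :=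
    fun w hw => by
      rw [weight_relFreq, weight_relFreq]
      congr 1
      have hw' : ((∑ i ∈ Finset.range n, sqDistDiff G v w (ξ i ω) : ℤ) : ℝ) = 0 := by
        rw [hw, Int.cast_zero]
      rw [← sub_eq_zero, ← Finset.sum_sub_distrib, ← hw']
      push_cast [sqDistDiff]; rfl
  have h1 := congrArg Prod.fst hn
  have h2 := congrArg Prod.snd hn
  rw [Prod.fst_sum] at h1
  rw [Prod.snd_sum] at h2
  exact ⟨key w₁ h1, key w₂ h2⟩

end Random

end Graph

end GraphMean

/-! ### The limit superior of the sample mean-sets -/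

theorem mainTheorem3 {V : Type*} [MeasurableSpace V] [MeasurableSingletonClass V]
    (G : SimpleGraph V) [G.LocallyFinite] (hconn : G.Connected)
    {Ω : Type*} [MeasurableSpace Ω] (P : Measure Ω) [IsProbabilityMeasure P]
    (ξ : ℕ → Ω → V) (hmeas : ∀ i, Measurable (ξ i))
    (hindep : iIndepFun ξ P) (hident : ∀ i, IdentDistrib (ξ i) (ξ 0) P P)
    (htotal : GraphMean.WeightTotallyDefined G (GraphMean.vertexMeasure P (ξ 0)))
    (hcard_ge : 2 ≤ (GraphMean.meanSet G (GraphMean.vertexMeasure P (ξ 0))).encard)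
    (hcard_le : (GraphMean.meanSet G (GraphMean.vertexMeasure P (ξ 0))).encard ≤ 3) :
    ∀ᵐ ω ∂P,
      limsup (fun n : ℕ => GraphMean.sampleMeanSet G (fun i => ξ i ω) n) atTop =
        GraphMean.meanSet G (GraphMean.vertexMeasure P (ξ 0)) := by
  have hcount := GraphMean.countable_of_connected hconn
  obtain ⟨v, hv⟩ := GraphMean.exists_enum_of_encard_le_three hcard_ge hcard_le
  have hmem : ∀ j, v j ∈ GraphMean.meanSet G (GraphMean.vertexMeasure P (ξ 0)) := fun j => by
    rw [hv]; exact ⟨j, rfl⟩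
  filter_upwards [GraphMean.ae_tendsto_weight_relFreq hmeas hindep hident htotal,
    GraphMean.ae_frequently_weight_eq hconn hmeas hindep hident htotal (hmem 0) (hmem 1) (hmem 2)]
    with ω hT hF
  have hlt := GraphMean.eventually_weight_lt hconn hT (hmem 0)
  ext u
  rw [GraphMean.mem_limsup_iff_frequently]
  constructor
  · intro hu
    by_contra hne
    obtain ⟨n, hn, hlt'⟩ := (hu.and_eventually hlt).exists
    exact (hlt' u hne).not_ge (hn _)
  · intro hu
    -- At late return times the mean-set shares one sample weight and all other vertices are
    -- heavier.
    refine (hF.and_eventually hlt).mono fun n hn => ?_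
    have heq : ∀ w ∈ GraphMean.meanSet G (GraphMean.vertexMeasure P (ξ 0)),
        GraphMean.weight G (GraphMean.relFreq (fun i => ξ i ω) n) w =
          GraphMean.weight G (GraphMean.relFreq (fun i => ξ i ω) n) (v 0) := fun w hw => by
      rw [hv] at hw
      obtain ⟨j, rfl⟩ := hw
      fin_cases j
      · rfl
      · exact hn.1.1
      · exact hn.1.2
    intro w
    rw [heq u hu]
    by_cases hw : w ∈ GraphMean.meanSet G (GraphMean.vertexMeasure P (ξ 0))
    · exact (heq w hw).ge
    · exact (hn.2 w hw).le
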